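/- Let $p$ be a prime, let $k$ be an algebraic closure of $\mathbb F_p$, and let $L$ be an affine group scheme of finite type over $k$. Let $H$ be a group, let $\varpi\colon H\to L(k)$ be a homomorphism with finite image, and put $U:=\ker\varpi$ and $I(p):=H/U$, a finite group which is regarded as a subgroup of $L(k)$ via $\varpi$. Then for every simple $k[I(p)]$-module $V_\tau$ there exists a finite-dimensional rational representation $V$ of $L$ over $k$ such that the restriction $\mathrm{Res}^{L}_{I(p)}V$ contains a $k[I(p)]$-submodule isomorphic to $V_\tau$. (This applies in particular to the following case. Let $x$ be an $\overline{\mathbb F}_p$-point of the special fibre of the integral model of a Shimura variety of Hodge type with hyperspecial level at $p$. Take for $L$ the centralizer, in the reduction $G_k$ of the reductive group $G$, of a cocharacter that defines the Hodge filtration on $\mathbb D(\mathcal A_x)\otimes_W k$; for $H=I(\mathbb Z_p)$ the group of those self-quasi-isogenies of $\mathcal A_x$ over $\mathbb Q_p$ that fix the tensors and preserve the Dieudonné module $\mathbb D(\mathcal A_x)$; and for $\varpi$ the induced action on the graded module of the Hodge filtration of $\mathbb D(\mathcal A_x)\otimes_W k$, whose image in $L(k)$ is finite.) -/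

import Mathlib

open scoped TensorProduct

universe u v w x

/-- The group `L(k)` of `k`-rational points of the affine `k`-group scheme `L = Spec A`, where `A`
is a commutative Hopf algebra over `k`. Its elements are the `k`-algebra homomorphisms `A → k`, and
the group law is convolution, `(g * h)(a) = ∑ g(a₁) h(a₂)`, i.e. the one given by the group law
`L × L → L` whose comorphism is the comultiplication of `A`. -/
abbrev GroupPoints (k : Type u) (A : Type v) [Field k] [CommRing A] [HopfAlgebra k A] :
    Type (max u v) :=
  WithConv (A →ₐ[k] k)

/-- A rational representation on `V` of the affine group scheme `L = Spec A` over `k`: a right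
comodule structure on `V` over the Hopf algebra `A = k[L]`. -/
structure RationalRep (k : Type u) (A : Type v) (V : Type w) [Field k] [CommRing A]
    [HopfAlgebra k A] [AddCommGroup V] [Module k V] where
  /-- The coaction `V → V ⊗ k[L]`. -/
  coact : V →ₗ[k] V ⊗[k] A
  coassoc : (TensorProduct.assoc k V A A).toLinearMap ∘ₗ coact.rTensor A ∘ₗ coact =
    (Coalgebra.comul (R := k) (A := A)).lTensor V ∘ₗ coact
  counit_coact : (TensorProduct.rid k V).toLinearMap ∘ₗ
    (Coalgebra.counit (R := k) (A := A)).lTensor V ∘ₗ coact = LinearMap.id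

namespace RationalRep

variable {k : Type u} {A : Type v} {V : Type w} [Field k] [CommRing A] [HopfAlgebra k A]
  [AddCommGroup V] [Module k V]

/-- The endomorphism of `V` by which a point `g : A → k` acts: if the coaction sends `v` to
`∑ vᵢ ⊗ aᵢ`, then `g • v = ∑ g(aᵢ) vᵢ`. -/
noncomputable def act (ρ : RationalRep k A V) (g : GroupPoints k A) : V →ₗ[k] V :=
  (TensorProduct.rid k V).toLinearMap ∘ₗ g.ofConv.toLinearMap.lTensor V ∘ₗ ρ.coact

theorem act_one (ρ : RationalRep k A V) : ρ.act 1 = LinearMap.id := by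
  exact ρ.counit_coact

theorem act_mul (ρ : RationalRep k A V) (g h : GroupPoints k A) :
    ρ.act (g * h) = ρ.act g ∘ₗ ρ.act h := by
  have e1 : (TensorProduct.rid k V).toLinearMap ∘ₗ (g * h).ofConv.toLinearMap.lTensor V =
      ((TensorProduct.rid k V).toLinearMap ∘ₗ (LinearMap.mul' k k ∘ₗ
        TensorProduct.map g.ofConv.toLinearMap h.ofConv.toLinearMap).lTensor V) ∘ₗ
        (Coalgebra.comul (R := k) (A := A)).lTensor V := by
    rw [LinearMap.comp_assoc, ← LinearMap.lTensor_comp]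
    rfl
  have e2 : ((TensorProduct.rid k V).toLinearMap ∘ₗ (LinearMap.mul' k k ∘ₗ
        TensorProduct.map g.ofConv.toLinearMap h.ofConv.toLinearMap).lTensor V) ∘ₗ
        (TensorProduct.assoc k V A A).toLinearMap =
      ((TensorProduct.rid k V).toLinearMap ∘ₗ g.ofConv.toLinearMap.lTensor V) ∘ₗ
        (TensorProduct.rid k (V ⊗[k] A)).toLinearMap ∘ₗ
          h.ofConv.toLinearMap.lTensor (V ⊗[k] A) := by
    ext x a b
    simp [smul_smul, mul_comm]
  have e3 : ((TensorProduct.rid k (V ⊗[k] A)).toLinearMap ∘ₗ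
        h.ofConv.toLinearMap.lTensor (V ⊗[k] A)) ∘ₗ ρ.coact.rTensor A =
      ρ.coact ∘ₗ (TensorProduct.rid k V).toLinearMap ∘ₗ h.ofConv.toLinearMap.lTensor V := by
    ext x a
    simp
  calc ρ.act (g * h)
      = ((TensorProduct.rid k V).toLinearMap ∘ₗ (g * h).ofConv.toLinearMap.lTensor V) ∘ₗ
          ρ.coact := rfl
    _ = (((TensorProduct.rid k V).toLinearMap ∘ₗ (LinearMap.mul' k k ∘ₗ
        TensorProduct.map g.ofConv.toLinearMap h.ofConv.toLinearMap).lTensor V) ∘ₗ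
        (TensorProduct.assoc k V A A).toLinearMap) ∘ₗ ρ.coact.rTensor A ∘ₗ ρ.coact := by
      rw [e1, LinearMap.comp_assoc, ← ρ.coassoc]
      rfl
    _ = ((TensorProduct.rid k V).toLinearMap ∘ₗ g.ofConv.toLinearMap.lTensor V) ∘ₗ
        (((TensorProduct.rid k (V ⊗[k] A)).toLinearMap ∘ₗ
          h.ofConv.toLinearMap.lTensor (V ⊗[k] A)) ∘ₗ ρ.coact.rTensor A) ∘ₗ ρ.coact := by
      rw [e2]
      rfl
    _ = ρ.act g ∘ₗ ρ.act h := by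
      rw [e3]
      rfl

/-- The linear representation of the abstract group `L(k)` underlying a rational representation
of `L`. -/
noncomputable def toRepresentation (ρ : RationalRep k A V) : Representation k (GroupPoints k A) V where
  toFun := ρ.act
  map_one' := ρ.act_one
  map_mul' := ρ.act_mul

/-- The restriction of a rational representation of `L` along a homomorphism `Γ → L(k)`. -/
noncomputable def res (ρ : RationalRep k A V) {Γ : Type x} [Group Γ] (ι : Γ →* GroupPoints k A) :
    Representation k Γ V :=
  ρ.toRepresentation.comp ι

end RationalRep

/-- For a homomorphism `ϖ : H → L(k)` with kernel `U`, the quotient `I(p) = H / U`. -/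
abbrev LevelQuotient {k : Type u} {A : Type v} [Field k] [CommRing A] [HopfAlgebra k A]
    {H : Type w} [Group H] (ϖ : H →* GroupPoints k A) : Type w :=
  H ⧸ ϖ.ker

/-- The embedding `I(p) = H / U ↪ L(k)` induced by `ϖ`, by which `I(p)` is regarded as a subgroup
of `L(k)`. -/
noncomputable abbrev levelEmbedding {k : Type u} {A : Type v} [Field k] [CommRing A] [HopfAlgebra k A]
    {H : Type w} [Group H] (ϖ : H →* GroupPoints k A) : LevelQuotient ϖ →* GroupPoints k A :=
  QuotientGroup.kerLift ϖ

/-! Write Γ for the finite group in L(k). By Dedekind's independence of characters some regular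
function e restricts to the delta function at 1 on Γ. The coefficients of its coproduct span a
finite-dimensional subcomodule of k[L] containing e. For a linear form l on the simple module S, s ↦
∑ l(γs) γ⁻¹e is Γ-equivariant, and its value at the point 1 is l(s), since e(γ⁻¹) = 0 for γ ≠ 1. So
it is nonzero when l ≠ 0, hence injective by simplicity. Nothing is divided by |Γ|, so p may divide
this order. -/

/-- An element of `M ⊗ N`, seen as a linear map from the dual of `N` to `M`. -/
noncomputable def contractDual (k : Type*) (M N : Type*) [Field k] [AddCommGroup M] [Module k M]
    [AddCommGroup N] [Module k N] : M ⊗[k] N →ₗ[k] (Module.Dual k N →ₗ[k] M) :=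
  TensorProduct.lift (LinearMap.mk₂ k
    (fun m n => (LinearMap.toSpanSingleton k M m) ∘ₗ Module.Dual.eval k N n)
    (by intros; ext; simp)
    (fun c m n => LinearMap.ext fun φ => smul_comm (φ n) c m)
    (by intros; ext; simp [add_smul]) (by intros; ext; simp [smul_smul]))

section Contract

variable {k M N : Type*} [Field k] [AddCommGroup M] [Module k M] [AddCommGroup N] [Module k N]

@[simp]
theorem contractDual_tmul (m : M) (n : N) (φ : Module.Dual k N) :
    contractDual k M N (m ⊗ₜ n) φ = φ n • m := by
  simp [contractDual]

theorem contractDual_apply (t : M ⊗[k] N) (φ : Module.Dual k N) :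
    contractDual k M N t φ = TensorProduct.rid k M (φ.lTensor M t) := by
  induction t with
  | zero => simp
  | tmul m n => simp
  | add s t hs ht => simp [hs, ht]

theorem finiteDimensional_range_contractDual (t : M ⊗[k] N) :
    FiniteDimensional k (LinearMap.range (contractDual k M N t)) := by
  induction t with
  | zero => rw [map_zero, LinearMap.range_zero]; infer_instance
  | tmul m n =>
    have hle : LinearMap.range (contractDual k M N (m ⊗ₜ n)) ≤ Submodule.span k {m} := by
      rintro _ ⟨φ, rfl⟩
      rw [contractDual_tmul]
      exact Submodule.smul_mem _ _ (Submodule.mem_span_singleton_self m)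
    exact Submodule.finiteDimensional_of_le hle
  | add s t hs ht =>
    rw [map_add]
    exact Submodule.finiteDimensional_of_le (LinearMap.range_add_le _ _)

/-- A tensor whose contractions all lie in `W` comes from `W ⊗ N`. -/
theorem mem_range_rTensor_subtype {W : Submodule k M} {t : M ⊗[k] N}
    (h : ∀ φ, contractDual k M N t φ ∈ W) : t ∈ LinearMap.range (W.subtype.rTensor N) := by
  classical
  -- In a basis of `N`, the coefficients of `t` are its contractions with the coordinate forms.
  let b := Module.Basis.ofVectorSpace k N
  rw [← (TensorProduct.equivFinsuppOfBasisRight (M := M) b).symm_apply_apply t,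
    TensorProduct.equivFinsuppOfBasisRight_symm_apply]
  refine Submodule.sum_mem _ fun i _ => ?_
  rw [TensorProduct.equivFinsuppOfBasisRight_apply, ← contractDual_apply]
  exact ⟨⟨_, h (b.coord i)⟩ ⊗ₜ b i, by simp⟩

end Contract

section Comodule

variable {k : Type u} {A : Type v} [Field k] [CommRing A] [HopfAlgebra k A]

/-- Local finiteness of the regular comodule. -/
theorem exists_finiteDimensional_subcomodule (e : A) :
    ∃ W : Submodule k A, FiniteDimensional k W ∧ e ∈ W ∧
      ∀ a ∈ W, Coalgebra.comul (R := k) a ∈ LinearMap.range (W.subtype.rTensor A) := by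
  set W := LinearMap.range (contractDual k A A (Coalgebra.comul (R := k) e)) with hW
  -- Contracting Δ(e) with the counit gives back `e`.
  refine ⟨W, finiteDimensional_range_contractDual _, ⟨Coalgebra.counit, ?_⟩, ?_⟩
  · simp [contractDual_apply, Coalgebra.lTensor_counit_comul]
  · rintro _ ⟨φ, rfl⟩
    apply mem_range_rTensor_subtype
    intro ψ
    -- The witness is the convolution of ψ and φ: by coassociativity, contracting Δ(e) with φ and
    -- then the coproduct of the result with ψ amounts to contracting Δ(e) with it.
    refine ⟨LinearMap.mul' k k ∘ₗ TensorProduct.map ψ φ ∘ₗ Coalgebra.comul, ?_⟩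
    have h1 : ∀ t : A ⊗[k] A, contractDual k A A t
        (LinearMap.mul' k k ∘ₗ TensorProduct.map ψ φ ∘ₗ Coalgebra.comul) =
        TensorProduct.rid k A ((LinearMap.mul' k k ∘ₗ TensorProduct.map ψ φ).lTensor A
          ((Coalgebra.comul (R := k) (A := A)).lTensor A t)) := by
      intro t
      rw [contractDual_apply, ← LinearMap.comp_apply (LinearMap.lTensor _ _),
        ← LinearMap.lTensor_comp]
      rfl
    have h2 : ∀ s : (A ⊗[k] A) ⊗[k] A,
        TensorProduct.rid k A ((LinearMap.mul' k k ∘ₗ TensorProduct.map ψ φ).lTensor A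
          (TensorProduct.assoc k A A A s)) =
        contractDual k A A (contractDual k (A ⊗[k] A) A s φ) ψ := by
      intro s
      induction s with
      | zero => simp
      | add s t hs ht => simp only [map_add, hs, ht, LinearMap.add_apply]
      | tmul s c =>
        induction s with
        | zero => simp
        | add s t hs ht =>
          simp only [TensorProduct.add_tmul, map_add, hs, ht, LinearMap.add_apply]
        | tmul a b => simp [smul_smul, mul_comm]
    have h3 : ∀ t : A ⊗[k] A,
        contractDual k (A ⊗[k] A) A ((Coalgebra.comul (R := k) (A := A)).rTensor A t) φ =
        Coalgebra.comul (R := k) (contractDual k A A t φ) := by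
      intro t
      induction t with
      | zero => simp
      | add s t hs ht => simp only [map_add, hs, ht, LinearMap.add_apply]
      | tmul a b => simp
    rw [h1, ← Coalgebra.coassoc_apply, h2, h3]

variable {V : Type w} [AddCommGroup V] [Module k V]

/-- A subspace of `k[L]` stable under the comultiplication is a rational representation. -/
theorem exists_rationalRep_of_injective (ι : V →ₗ[k] A) (hι : Function.Injective ι)
    (h : ∀ v, Coalgebra.comul (R := k) (ι v) ∈ LinearMap.range (ι.rTensor A)) :
    ∃ ρ : RationalRep k A V, ι.rTensor A ∘ₗ ρ.coact = Coalgebra.comul ∘ₗ ι := by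
  have hi : Function.Injective (ι.rTensor A) :=
    Module.Flat.rTensor_preserves_injective_linearMap ι hι
  have hii : Function.Injective (ι.rTensor (A ⊗[k] A)) :=
    Module.Flat.rTensor_preserves_injective_linearMap ι hι
  let c : V →ₗ[k] V ⊗[k] A :=
    (LinearEquiv.ofInjective (ι.rTensor A) hi).symm.toLinearMap ∘ₗ
      (Coalgebra.comul ∘ₗ ι).codRestrict _ h
  have hc : ι.rTensor A ∘ₗ c = Coalgebra.comul ∘ₗ ι := by
    ext v
    exact congrArg Subtype.val ((LinearEquiv.ofInjective (ι.rTensor A) hi).apply_symm_apply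
      ((Coalgebra.comul ∘ₗ ι).codRestrict _ h v))
  have hc' : ∀ v, ι.rTensor A (c v) = Coalgebra.comul (R := k) (ι v) := LinearMap.congr_fun hc
  -- Both axioms are checked after applying the injection `ι`, where they become those of the
  -- coalgebra `A`.
  refine ⟨⟨c, ?_, ?_⟩, hc⟩
  · ext v
    apply hii
    have h1 : ∀ s : (V ⊗[k] A) ⊗[k] A, ι.rTensor (A ⊗[k] A) (TensorProduct.assoc k V A A s) =
        TensorProduct.assoc k A A A ((ι.rTensor A).rTensor A s) := by
      intro s
      exact LinearMap.congr_fun (f := ι.rTensor (A ⊗[k] A) ∘ₗ (TensorProduct.assoc k V A A))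
        (g := (TensorProduct.assoc k A A A).toLinearMap ∘ₗ (ι.rTensor A).rTensor A)
        (by ext; simp) s
    have h2 : ∀ s : V ⊗[k] A, (ι.rTensor A).rTensor A (c.rTensor A s) =
        (Coalgebra.comul (R := k) (A := A)).rTensor A (ι.rTensor A s) := by
      intro s
      rw [← LinearMap.comp_apply, ← LinearMap.rTensor_comp, hc, LinearMap.rTensor_comp]
      rfl
    have h3 : ∀ s : V ⊗[k] A, ι.rTensor (A ⊗[k] A) (Coalgebra.comul.lTensor V s) =
        (Coalgebra.comul (R := k) (A := A)).lTensor A (ι.rTensor A s) := by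
      intro s
      simp only [← LinearMap.comp_apply, LinearMap.rTensor_comp_lTensor,
        LinearMap.lTensor_comp_rTensor]
    simp only [LinearMap.comp_apply, LinearEquiv.coe_coe]
    rw [h1, h2, h3, hc', Coalgebra.coassoc_apply]
  · ext v
    apply hι
    have h1 : ∀ s : V ⊗[k] A, ι (TensorProduct.rid k V (Coalgebra.counit.lTensor V s)) =
        TensorProduct.rid k A ((Coalgebra.counit (R := k) (A := A)).lTensor A
          (ι.rTensor A s)) := by
      intro s
      induction s with
      | zero => simp
      | add s t hs ht => simp only [map_add, hs, ht]
      | tmul a b => simp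
    simp only [LinearMap.comp_apply, LinearEquiv.coe_coe, LinearMap.id_apply]
    rw [h1, hc', Coalgebra.lTensor_counit_comul]
    simp

/-- A matrix coefficient of a subrepresentation of `k[L]` under right translation: the value of
`g • v` at `h` is the value of `v` at `h * g`. -/
theorem RationalRep.apply_act_of_comul (ρ : RationalRep k A V) (ι : V →ₗ[k] A)
    (hρ : ι.rTensor A ∘ₗ ρ.coact = Coalgebra.comul ∘ₗ ι) (g h : GroupPoints k A) (v : V) :
    h.ofConv (ι (ρ.act g v)) = (h * g).ofConv (ι v) := by
  have h1 : ∀ s : V ⊗[k] A,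
      h.ofConv (ι (TensorProduct.rid k V (g.ofConv.toLinearMap.lTensor V s))) =
      LinearMap.mul' k k (TensorProduct.map h.ofConv.toLinearMap g.ofConv.toLinearMap
        (ι.rTensor A s)) := by
    intro s
    induction s with
    | zero => simp
    | add s t hs ht => simp only [map_add, hs, ht]
    | tmul a b => simp [mul_comm]
  have h2 := LinearMap.congr_fun hρ v
  simp only [LinearMap.comp_apply] at h2
  refine (h1 _).trans ?_
  rw [h2]
  rfl

theorem exists_finiteDimensional_rationalRep (e : A) :
    ∃ (n : ℕ) (ρ : RationalRep k A (Fin n → k)) (ι : (Fin n → k) →ₗ[k] A) (w : Fin n → k),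
      ι w = e ∧ ∀ (g h : GroupPoints k A) (v : Fin n → k),
        h.ofConv (ι (ρ.act g v)) = (h * g).ofConv (ι v) := by
  obtain ⟨W, hfin, he, hW⟩ := exists_finiteDimensional_subcomodule (k := k) e
  -- Coordinates move `W` from the universe of `A` to that of `k`.
  let E := (Module.finBasis k W).equivFun.symm
  have hinj : Function.Injective (W.subtype ∘ₗ E.toLinearMap) :=
    W.injective_subtype.comp E.injective
  obtain ⟨ρ, hρ⟩ := exists_rationalRep_of_injective (W.subtype ∘ₗ E.toLinearMap) hinj (by
    intro v
    obtain ⟨t, ht⟩ := hW _ (E v).2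
    obtain ⟨s, rfl⟩ := (E.rTensor A).surjective t
    refine ⟨s, ?_⟩
    rw [LinearMap.rTensor_comp]
    exact ht)
  exact ⟨_, ρ, _, E.symm ⟨e, he⟩, by simp, ρ.apply_act_of_comul _ hρ⟩

/-- Finitely many distinct points of `L` are separated by a regular function. -/
theorem exists_apply_eq_of_injective {Γ : Type*} [Finite Γ] {ev : Γ → A →ₐ[k] k}
    (hev : Function.Injective ev) (c : Γ → k) : ∃ a : A, ∀ γ, ev γ a = c γ := by
  classical
  cases nonempty_fintype Γ
  have hli : LinearIndependent k fun γ => (ev γ).toLinearMap :=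
    (linearIndependent_algHom_toLinearMap k A k).comp ev hev
  let F : A →ₗ[k] Γ → k := LinearMap.pi fun γ => (ev γ).toLinearMap
  have hF : LinearMap.range F = ⊤ := by
    -- A nonzero form vanishing on the image would be a linear relation between the distinct
    -- characters `ev γ`.
    by_contra hne
    obtain ⟨φ, hφ, hle⟩ := Submodule.exists_le_ker_of_lt_top _ (lt_top_iff_ne_top.2 hne)
    have hsum : ∑ γ, φ (Pi.single γ 1) • (ev γ).toLinearMap = 0 := by
      ext a
      have h0 : φ (F a) = 0 := hle ⟨a, rfl⟩
      rw [LinearMap.pi_apply_eq_sum_univ φ (F a)] at h0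
      have hsingle : ∀ γ : Γ, (fun i => if γ = i then (1 : k) else 0) = Pi.single γ 1 :=
        fun γ => funext fun i => by simp [Pi.single_apply, eq_comm]
      simpa [F, mul_comm, hsingle] using h0
    refine hφ (LinearMap.pi_ext' fun γ => LinearMap.ext_ring ?_)
    simpa using Fintype.linearIndependent_iff.1 hli _ hsum γ
  obtain ⟨a, ha⟩ := LinearMap.range_eq_top.1 hF c
  exact ⟨a, fun γ => congrFun ha γ⟩

/-- A simple module of a finite subgroup of `L(k)` embeds into a finite-dimensional rational
representation of `L`. -/
theorem exists_rationalRep_injective {Γ : Type*} [Group Γ] [Finite Γ] (j : Γ →* GroupPoints k A)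
    (hj : Function.Injective j) (S : Type*) [AddCommGroup S] [Module k S]
    [Module (MonoidAlgebra k Γ) S] [IsScalarTower k (MonoidAlgebra k Γ) S]
    [IsSimpleModule (MonoidAlgebra k Γ) S] :
    ∃ (n : ℕ) (ρ : RationalRep k A (Fin n → k))
      (f : S →ₗ[MonoidAlgebra k Γ] (ρ.res j).asModule), Function.Injective f := by
  classical
  cases nonempty_fintype Γ
  obtain ⟨e, he⟩ := exists_apply_eq_of_injective (ev := fun γ => (j γ).ofConv)
    (fun a b hab => hj (WithConv.ofConv_injective hab)) (Pi.single (1 : Γ) (1 : k))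
  obtain ⟨n, ρ, ι, w, hw, hι⟩ := exists_finiteDimensional_rationalRep (k := k) e
  have : Nontrivial S := IsSimpleModule.nontrivial (MonoidAlgebra k Γ) S
  obtain ⟨s₀, hs₀⟩ := exists_ne (0 : S)
  obtain ⟨l, hl⟩ : ∃ l : Module.Dual k S, l s₀ ≠ 0 := by
    by_contra! hcon
    exact hs₀ ((Module.forall_dual_apply_eq_zero_iff k s₀).1 hcon)
  let σ : Representation k Γ (Fin n → k) := ρ.res j
  let T : Γ → S →ₗ[k] S := fun γ => Module.toModuleEnd k (S := MonoidAlgebra k Γ) S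
    (MonoidAlgebra.single γ 1)
  have hT : ∀ γ s, T γ s = MonoidAlgebra.single γ (1 : k) • s := fun _ _ => rfl
  let f₀ : S →ₗ[k] (Fin n → k) := ∑ γ : Γ, (l ∘ₗ T γ).smulRight (σ γ⁻¹ w)
  have hf₀ : ∀ s, f₀ s = ∑ γ : Γ, l (MonoidAlgebra.single γ (1 : k) • s) • σ γ⁻¹ w := by
    intro s
    simp [f₀, hT]
  have hequi : ∀ g s, f₀ (MonoidAlgebra.single g (1 : k) • s) = σ g (f₀ s) := by
    intro g s
    rw [hf₀, hf₀, map_sum]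
    -- Substituting γg for γ turns g(γg)⁻¹ into γ⁻¹.
    refine Fintype.sum_equiv (Equiv.mulRight g) _ _ fun γ => ?_
    simp [smul_smul, MonoidAlgebra.single_mul_single, ← Module.End.mul_apply, ← map_mul]
  let f : S →ₗ[MonoidAlgebra k Γ] σ.asModule :=
    MonoidAlgebra.equivariantOfLinearOfComm (σ.asModuleEquiv.symm.toLinearMap ∘ₗ f₀)
      fun g s => by
        rw [Representation.single_smul, one_smul]
        exact hequi g s
  have hval : (1 : GroupPoints k A).ofConv (ι (f₀ s₀)) = l s₀ := by
    rw [hf₀, map_sum, map_sum, Finset.sum_eq_single 1]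
    · have : (1 : GroupPoints k A).ofConv e = 1 := by simpa using he 1
      simp [hw, this, ← MonoidAlgebra.one_def]
    · intro γ _ hγ
      have h1 : (1 : GroupPoints k A).ofConv (ι (σ γ⁻¹ w)) = 0 := by
        refine (hι (j γ⁻¹) 1 w).trans ?_
        rw [one_mul, hw, he, Pi.single_eq_of_ne (inv_ne_one.2 hγ)]
      rw [map_smul, map_smul, h1, smul_zero]
    · simp
  refine ⟨n, ρ, f, LinearMap.injective_of_ne_zero fun hf => hl ?_⟩
  have h0 : f₀ s₀ = 0 := LinearMap.congr_fun hf s₀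
  rw [← hval, h0, map_zero, map_zero]

end Comodule

theorem lemma3 (p : ℕ) [Fact p.Prime]
    (k : Type u) [Field k] [Algebra (ZMod p) k] [IsAlgClosure (ZMod p) k]
    (A : Type v) [CommRing A] [HopfAlgebra k A] [Algebra.FiniteType k A]
    (H : Type w) [Group H] (ϖ : H →* GroupPoints k A) [Finite (LevelQuotient ϖ)]
    (Vτ : Type x) [AddCommGroup Vτ] [Module (MonoidAlgebra k (LevelQuotient ϖ)) Vτ]
    [IsSimpleModule (MonoidAlgebra k (LevelQuotient ϖ)) Vτ] :
    ∃ (V : Type u) (_ : AddCommGroup V) (_ : Module k V) (_ : FiniteDimensional k V)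
      (ρ : RationalRep k A V)
      (f : Vτ →ₗ[MonoidAlgebra k (LevelQuotient ϖ)] (ρ.res (levelEmbedding ϖ)).asModule),
      Function.Injective f := by
  -- The `k`-structure is the one induced by the group algebra.
  let _ : Module k Vτ := Module.compHom Vτ (algebraMap k (MonoidAlgebra k (LevelQuotient ϖ)))
  have : IsScalarTower k (MonoidAlgebra k (LevelQuotient ϖ)) Vτ :=
    ⟨fun a b s => by rw [Algebra.smul_def, mul_smul]; rfl⟩
  obtain ⟨n, ρ, f, hf⟩ := exists_rationalRep_injective (levelEmbedding ϖ)
    (QuotientGroup.kerLift_injective ϖ) Vτ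
  exact ⟨Fin n → k, inferInstance, inferInstance, inferInstance, ρ, f, hf⟩
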